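/- **Spectral Theorem for representations.** Let $A$ be a commutative complex $*$-algebra (not necessarily unital or normed), let $H\neq\{0\}$ be a complex Hilbert space, and let $\pi$ be a non-degenerate representation of $A$ in $H$, i.e. an algebra homomorphism from $A$ into the linear operators on $H$ with $\langle\pi(a)x,y\rangle=\langle x,\pi(a^*)y\rangle$ for all $a\in A$, $x,y\in H$ (the operators $\pi(a)$ are then automatically bounded), such that $\pi(a)x=0$ for all $a\in A$ only if $x=0$. Let $B$ be the norm closure of $\pi(A)$ in $B(H)$, let $\Delta(B)$ be the set of non-zero multiplicative linear functionals on $B$, and put $$\mathrm{sp}(\pi):=\{\tau\circ\pi:\tau\in\Delta(B)\},$$ equipped with the weak* topology (pointwise convergence on $A$). Then $\mathrm{sp}(\pi)$ is contained in the set $\Delta^*(A)$ of non-zero multiplicative linear functionals $\sigma$ on $A$ with $\sigma(a^*)=\overline{\sigma(a)}$, it is a non-empty locally compact Hausdorff space, and there exists a unique resolution of identity $P$ on $\mathrm{sp}(\pi)$, acting on $H$, such that, with $\widehat a(\sigma):=\sigma(a)$, $$\pi(a)=\int_{\mathrm{sp}(\pi)}\widehat a\,dP\quad\text{(in norm)}\qquad\text{for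 all }a\in A.$$ Moreover, the commutants coincide, $\pi'=P'$ (that is, a bounded operator on $H$ commutes with all $\pi(a)$ if and only if it commutes with all $P(\omega)$), and the support of $P$ is all of $\mathrm{sp}(\pi)$. Here a *resolution of identity* on a non-empty locally compact Hausdorff space $\Omega$ is a map $P$ from the Borel sets of $\Omega$ to the orthogonal projections in $B(H)$ with $P(\Omega)=\mathbf 1$ such that for every $x\in H$ the function $\omega\mapsto\langle P(\omega)x,x\rangle$ is a measure that is inner regular with respect to compact sets. For a bounded Borel function $f$ on $\Omega$ and $T\in B(H)$, one writes $T=\int f\,dP$ (in norm) if $\|T-\sum_\alpha\alpha P(h=\alpha)\|\le\sup_{\Omega}|f-h|$ for every Borel step function $h$ on $\Omega$, the sum running over the finitely many values $\alpha$ of $h$. The *support* of $P$ is the complement of the largest open set $\omega$ with $P(\omega)=0$, if such a largest set exists. -/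

import Mathlib

open MeasureTheory

/-- A representation of a `*`-algebra `A` in a (pre-)Hilbert space `H`: an algebra homomorphism
into the algebra of all linear operators on `H` satisfying `⟨π(a)x, y⟩ = ⟨x, π(a*)y⟩`.
Boundedness of the operators is not part of the definition. -/
structure StarRep (A : Type*) (H : Type*) [NonUnitalRing A] [Module ℂ A] [Star A]
    [NormedAddCommGroup H] [InnerProductSpace ℂ H] where
  toHom : A →ₙₐ[ℂ] Module.End ℂ H
  inner_left' : ∀ (a : A) (x y : H), inner ℂ (toHom a x) y = inner ℂ x (toHom (star a) y)

namespace StarRep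

/-- On a Hilbert space the operators of a representation are automatically bounded. -/
theorem continuous_apply {A : Type*} {H : Type*} [NonUnitalRing A] [Module ℂ A] [Star A]
    [NormedAddCommGroup H] [InnerProductSpace ℂ H] [CompleteSpace H]
    (π : StarRep A H) (a : A) : Continuous (π.toHom a) := by
  refine (π.toHom a).continuous_of_seq_closed_graph fun u x y hu hTu ↦ ?_
  rw [← sub_eq_zero, ← @inner_self_eq_zero ℂ]
  have hlhs : ∀ k : ℕ, inner ℂ (π.toHom a (u k) - π.toHom a x) (y - π.toHom a x) =
      inner ℂ (u k - x) (π.toHom (star a) (y - π.toHom a x)) := by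
    intro k
    rw [← map_sub, π.inner_left']
  refine tendsto_nhds_unique ((hTu.sub_const _).inner tendsto_const_nhds) ?_
  simp_rw [Function.comp_apply, hlhs]
  rw [← inner_zero_left (𝕜 := ℂ) (π.toHom (star a) (y - π.toHom a x))]
  refine Filter.Tendsto.inner ?_ tendsto_const_nhds
  rw [← sub_self x]
  exact hu.sub_const _

variable {A : Type*} {H : Type*} [NonUnitalCommRing A] [Module ℂ A] [StarRing A]
  [NormedAddCommGroup H] [InnerProductSpace ℂ H] [CompleteSpace H]

/-- The representation viewed as a `*`-algebra homomorphism `A → B(H)`. -/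
noncomputable def toStarHom (π : StarRep A H) : A →⋆ₙₐ[ℂ] (H →L[ℂ] H) where
  toFun a := ⟨π.toHom a, π.continuous_apply a⟩
  map_smul' c a := by ext x; simp
  map_zero' := by ext x; simp
  map_add' a b := by ext x; simp
  map_mul' a b := by ext x; simp
  map_star' a := by
    rw [ContinuousLinearMap.star_eq_adjoint, ContinuousLinearMap.eq_adjoint_iff]
    intro x y
    simpa using π.inner_left' (star a) x y

/-- `π` is non-degenerate: the subspace of all `x` with `π(a)x = 0` for every `a` is `{0}`. -/
def NonDegenerate (π : StarRep A H) : Prop :=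
  ∀ x : H, (∀ a : A, π.toStarHom a x = 0) → x = 0

/-- The closure `B` of the range `R(π)` in `B(H)`, with respect to the operator norm. -/
noncomputable def closedRange (π : StarRep A H) : NonUnitalStarSubalgebra ℂ (H →L[ℂ] H) :=
  (NonUnitalStarAlgHom.range π.toStarHom).topologicalClosure

/-- `π` viewed as a homomorphism from `A` into the closure of its range. -/
noncomputable def toClosedRange (π : StarRep A H) : A →ₙₐ[ℂ] π.closedRange :=
  (NonUnitalStarAlgHom.codRestrict π.toStarHom π.closedRange
    fun a => subset_closure ⟨a, rfl⟩).toNonUnitalAlgHom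

end StarRep

/-- `Δ(A)`: the multiplicative linear functionals on `A`, that is, the non-zero linear functionals
`τ` with `τ(ab) = τ(a)τ(b)` (no continuity is required). -/
def multFunctionals (A : Type*) [NonUnitalRing A] [Module ℂ A] : Set (A →ₙₐ[ℂ] ℂ) :=
  {τ | τ ≠ 0}

/-- `Δ*(A)`: the Hermitian multiplicative linear functionals on the `*`-algebra `A`. -/
def hermitianMultFunctionals (A : Type*) [NonUnitalRing A] [Module ℂ A] [Star A] :
    Set (A →ₙₐ[ℂ] ℂ) :=
  {τ | τ ∈ multFunctionals A ∧ ∀ a : A, τ (star a) = star (τ a)}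

/-- The weak* topology: the coarsest topology making all evaluations `τ ↦ τ(a)` continuous. -/
noncomputable instance weakStarTopology {A : Type*} [NonUnitalRing A] [Module ℂ A] :
    TopologicalSpace (A →ₙₐ[ℂ] ℂ) :=
  TopologicalSpace.induced (fun τ (a : A) => τ a) inferInstance

noncomputable instance weakStarMeasurableSpace {A : Type*} [NonUnitalRing A] [Module ℂ A] :
    MeasurableSpace (A →ₙₐ[ℂ] ℂ) :=
  borel _

instance weakStarBorelSpace {A : Type*} [NonUnitalRing A] [Module ℂ A] :
    BorelSpace (A →ₙₐ[ℂ] ℂ) :=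
  ⟨rfl⟩

/-- `sp(π) = {τ ∘ π : τ ∈ Δ(B)}`, where `B` is the closure of the range of `π`. It carries the
weak* topology and its Borel σ-algebra. -/
noncomputable def StarRep.sp {A : Type*} {H : Type*} [NonUnitalCommRing A] [Module ℂ A] [StarRing A]
    [NormedAddCommGroup H] [InnerProductSpace ℂ H] [CompleteSpace H] (π : StarRep A H) :
    Set (A →ₙₐ[ℂ] ℂ) :=
  (fun τ : π.closedRange →ₙₐ[ℂ] ℂ => τ.comp π.toClosedRange) '' multFunctionals π.closedRange

/-- A spectral measure on the measurable space `Ω`, acting on `H`: a map from the σ-algebra of `Ω`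
to the projections in `H` with `P(Ω) = 1` and such that `ω ↦ ⟨P(ω)x, x⟩` is a measure for every
`x`. -/
structure SpectralMeasure (Ω : Type*) [MeasurableSpace Ω] (H : Type*)
    [NormedAddCommGroup H] [InnerProductSpace ℂ H] [CompleteSpace H] where
  toFun : {ω : Set Ω // MeasurableSet ω} → (H →L[ℂ] H)
  isStarProjection' : ∀ ω, IsStarProjection (toFun ω)
  map_univ' : toFun ⟨Set.univ, MeasurableSet.univ⟩ = 1
  exists_measure' : ∀ x : H, ∃ μ : Measure Ω, ∀ ω : {ω : Set Ω // MeasurableSet ω},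
    μ ω = ENNReal.ofReal (RCLike.re (inner ℂ (toFun ω x) x))

namespace SpectralMeasure

variable {Ω : Type*} [MeasurableSpace Ω] {H : Type*}
  [NormedAddCommGroup H] [InnerProductSpace ℂ H] [CompleteSpace H]

/-- The measure `⟨Px, x⟩`. -/
noncomputable def measure (P : SpectralMeasure Ω H) (x : H) : Measure Ω :=
  (P.exists_measure' x).choose

theorem measure_apply (P : SpectralMeasure Ω H) (x : H) {ω : Set Ω} (hω : MeasurableSet ω) :
    P.measure x ω = ENNReal.ofReal (RCLike.re (inner ℂ (P.toFun ⟨ω, hω⟩ x) x)) :=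
  (P.exists_measure' x).choose_spec ⟨ω, hω⟩

/-- `I_P(h) = ∑ α P(h = α)`, the integral of a step function `h`. -/
noncomputable def stepIntegral (P : SpectralMeasure Ω H) (h : SimpleFunc Ω ℂ) : H →L[ℂ] H :=
  ∑ α ∈ h.range, α • P.toFun ⟨h ⁻¹' {α}, h.measurableSet_fiber α⟩

/-- `T = ∫ f dP` in norm: `f` is a bounded measurable function, and `‖T - I_P(h)‖ ≤ |f - h|_∞` for
every step function `h`, where `|·|_∞` is the supremum norm. -/
def HasNormIntegral (P : SpectralMeasure Ω H) (f : Ω → ℂ) (T : H →L[ℂ] H) : Prop :=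
  Measurable f ∧ (∃ C : ℝ, ∀ s, ‖f s‖ ≤ C) ∧
    ∀ h : SimpleFunc Ω ℂ, ‖T - P.stepIntegral h‖ ≤ ⨆ s, ‖f s - h s‖

/-- `P` is a resolution of identity: `Ω` is a non-empty locally compact Hausdorff space with its
Borel σ-algebra, and each measure `⟨Px, x⟩` is inner regular with respect to compact sets. -/
def IsResolutionOfIdentity [TopologicalSpace Ω] [BorelSpace Ω] (P : SpectralMeasure Ω H) : Prop :=
  Nonempty Ω ∧ LocallyCompactSpace Ω ∧ T2Space Ω ∧ ∀ x : H, (P.measure x).InnerRegular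

/-- `S` is the support of `P`: its complement is the largest open set `ω` with `P(ω) = 0`. -/
def IsSupport [TopologicalSpace Ω] [BorelSpace Ω] (P : SpectralMeasure Ω H) (S : Set Ω) : Prop :=
  IsGreatest {ω : Set Ω | ∃ hω : IsOpen ω, P.toFun ⟨ω, hω.measurableSet⟩ = 0} Sᶜ

end SpectralMeasure

/-! The closure `B` is a commutative C⋆-algebra, so Gelfand duality identifies its unitization with
C(X), where X is the compact space of characters of the unitization, and the inclusion of `B` in
B(H) becomes a unital star homomorphism φ on C(X). For each vector x, Riesz representation turns f ↦
⟨φ(f)x, x⟩ into a finite regular measure μ_x, and ‖φ(f)x‖ is the L²(μ_x) norm of f (`eLpNorm_coe`).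
This isometry extends φ to bounded Borel functions: g is approximated by continuous functions in
L²(μ_x), simultaneously for any finite set of vectors, and the resulting limits respect sums,
products and adjoints. The values at indicators are the spectral projections.

The set sp(π) embeds in X as the open set of characters not vanishing on `B`
(`isOpenEmbedding_toUnitizedSpectrum`). Non-degeneracy says that the projection of its complement is
0 (`hasExtension_range`), so the spectral measure lives on sp(π).

Uniqueness holds because a resolution of identity with the given integrals, pushed forward to X,
integrates continuous functions as the μ_x do; Riesz uniqueness and polarization finish. The
commutants agree since projections are strong limits of operators φ(f), while each π(a) is a norm
limit of step integrals. The support is full by Urysohn and the injectivity of the inclusion of `B`.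
-/

open scoped ENNReal Topology CompactlySupported

namespace ContinuousMap

variable {X : Type*} [TopologicalSpace X]

/-- A real-valued continuous function, viewed as a complex-valued one. -/
def complexify (f : C(X, ℝ)) : C(X, ℂ) := ⟨fun s => (f s : ℂ), by fun_prop⟩

@[simp] theorem complexify_apply (f : C(X, ℝ)) (s : X) : f.complexify s = (f s : ℂ) := rfl

end ContinuousMap

/-! ### Extending a representation of C(X) to bounded Borel functions. -/

namespace SpectralConstruction

/-- Bounded measurable functions. -/
def IsBoundedMeasurable {Ω : Type*} [MeasurableSpace Ω] (g : Ω → ℂ) : Prop :=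
  Measurable g ∧ ∃ C : ℝ, ∀ s, ‖g s‖ ≤ C

namespace IsBoundedMeasurable

variable {Ω : Type*} [MeasurableSpace Ω] {g h : Ω → ℂ}

theorem memLp (hg : IsBoundedMeasurable g) (μ : Measure Ω) [IsFiniteMeasure μ] :
    MemLp g 2 μ := by
  obtain ⟨hm, C, hC⟩ := hg
  exact MemLp.of_bound hm.aestronglyMeasurable C (.of_forall hC)

theorem add (hg : IsBoundedMeasurable g) (hh : IsBoundedMeasurable h) :
    IsBoundedMeasurable (g + h) := by
  obtain ⟨hm, C, hC⟩ := hg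
  obtain ⟨hm', C', hC'⟩ := hh
  exact ⟨hm.add hm', C + C', fun s => (norm_add_le _ _).trans (add_le_add (hC s) (hC' s))⟩

theorem mul (hg : IsBoundedMeasurable g) (hh : IsBoundedMeasurable h) :
    IsBoundedMeasurable (g * h) := by
  obtain ⟨hm, C, hC⟩ := hg
  obtain ⟨hm', C', hC'⟩ := hh
  exact ⟨hm.mul hm', C * C', fun s => (norm_mul_le _ _).trans
    (mul_le_mul (hC s) (hC' s) (norm_nonneg _) ((norm_nonneg _).trans (hC s)))⟩

theorem star (hg : IsBoundedMeasurable g) : IsBoundedMeasurable (star g) := by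
  obtain ⟨hm, C, hC⟩ := hg
  exact ⟨Complex.continuous_conj.measurable.comp hm, C, fun s => by simpa using hC s⟩

theorem indicator_one {ω : Set Ω} (hω : MeasurableSet ω) :
    IsBoundedMeasurable (ω.indicator 1) := by
  refine ⟨measurable_one.indicator hω, 1, fun s => ?_⟩
  by_cases hs : s ∈ ω <;> simp [hs]

end IsBoundedMeasurable

theorem isBoundedMeasurable_coe {X : Type*} [TopologicalSpace X] [CompactSpace X]
    [MeasurableSpace X] [BorelSpace X] (f : C(X, ℂ)) : IsBoundedMeasurable f :=
  ⟨f.continuous.measurable, ‖f‖, f.norm_coe_le_norm⟩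

theorem eLpNorm_sub_le_add {Ω : Type*} [MeasurableSpace Ω] {g h k : Ω → ℂ}
    (hg : IsBoundedMeasurable g) (hh : IsBoundedMeasurable h) (hk : IsBoundedMeasurable k) (μ : Measure Ω) :
    eLpNorm (g - k) 2 μ ≤ eLpNorm (g - h) 2 μ + eLpNorm (k - h) 2 μ := by
  rw [eLpNorm_sub_comm k h, ← sub_add_sub_cancel g h k]
  exact eLpNorm_add_le (hg.1.sub hh.1).aestronglyMeasurable (hh.1.sub hk.1).aestronglyMeasurable
    one_le_two

variable {X : Type*} [TopologicalSpace X] {H : Type*}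
  [NormedAddCommGroup H] [InnerProductSpace ℂ H] [CompleteSpace H]
  (φ : C(X, ℂ) →⋆ₐ[ℂ] (H →L[ℂ] H))

theorem inner_map_star_mul_self (f : C(X, ℂ)) (x : H) :
    inner ℂ (φ (star f * f) x) x = ((‖φ f x‖ ^ 2 : ℝ) : ℂ) := by
  rw [map_mul, map_star, ContinuousLinearMap.star_eq_adjoint, mul_apply_eq_comp,
    ContinuousLinearMap.adjoint_inner_left, inner_self_eq_norm_sq_to_K]
  simp

variable [CompactSpace X]

/-- The positive functional `f ↦ ⟨φ(f)x, x⟩` on real-valued functions. -/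
noncomputable def vectorFunctional (x : H) : C_c(X, ℝ) →ₚ[ℝ] ℝ :=
  PositiveLinearMap.mk₀
    { toFun := fun f => RCLike.re (inner ℂ (φ (f : C(X, ℝ)).complexify x) x)
      map_add' := fun f g => by
        have : ((f + g : C_c(X, ℝ)) : C(X, ℝ)).complexify =
          (f : C(X, ℝ)).complexify + (g : C(X, ℝ)).complexify := by ext; simp
        simp [this]
      map_smul' := fun c f => by
        have : ((c • f : C_c(X, ℝ)) : C(X, ℝ)).complexify =
          (c : ℂ) • (f : C(X, ℝ)).complexify := by ext; simp
        rw [this, map_smul]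
        simp }
    (fun f hf => by
      have : (f : C(X, ℝ)).complexify =
          star (ContinuousMap.complexify ⟨fun s => √(f s), by fun_prop⟩) *
            ContinuousMap.complexify ⟨fun s => √(f s), by fun_prop⟩ := by
        ext s
        have : 0 ≤ f s := hf s
        simp [← Complex.ofReal_mul, Real.mul_self_sqrt this]
      simp only [LinearMap.coe_mk, AddHom.coe_mk, this]
      rw [inner_map_star_mul_self]
      simp only [RCLike.re_to_complex, Complex.ofReal_re]
      positivity)

variable [T2Space X] [MeasurableSpace X] [BorelSpace X]

/-- The regular measure representing `f ↦ ⟨φ(f)x, x⟩`. -/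
noncomputable def vectorMeasure (x : H) : Measure X :=
  RealRMK.rieszMeasure (vectorFunctional φ x)

instance (x : H) : (vectorMeasure φ x).Regular := RealRMK.regular_rieszMeasure _

instance (x : H) : IsFiniteMeasure (vectorMeasure φ x) := inferInstance

theorem integral_vectorMeasure (x : H) (f : C(X, ℝ)) :
    ∫ s, f s ∂(vectorMeasure φ x) = RCLike.re (inner ℂ (φ f.complexify x) x) :=
  RealRMK.integral_rieszMeasure (vectorFunctional φ x)
    ⟨f, HasCompactSupport.of_compactSpace _⟩

/-- Both sides square to ⟨φ(f̄f)x, x⟩ = ∫ |f|². The whole extension rests on this isometry. -/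
theorem eLpNorm_coe (x : H) (f : C(X, ℂ)) :
    eLpNorm f 2 (vectorMeasure φ x) = ‖φ f x‖ₑ := by
  have hf : MemLp f 2 (vectorMeasure φ x) :=
    MemLp.of_bound f.continuous.aestronglyMeasurable ‖f‖ (.of_forall f.norm_coe_le_norm)
  rw [hf.eLpNorm_eq_integral_rpow_norm (by simp) (by simp)]
  have h := integral_vectorMeasure φ x ⟨fun s => ‖f s‖ ^ 2, by fun_prop⟩
  have h' : ContinuousMap.complexify ⟨fun s => ‖f s‖ ^ 2, by fun_prop⟩ = star f * f := by
    ext s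
    simp [Complex.conj_mul']
  rw [h', inner_map_star_mul_self] at h
  simp only [ContinuousMap.coe_mk, RCLike.re_to_complex, Complex.ofReal_re] at h
  simp only [ENNReal.toReal_ofNat, Real.rpow_ofNat, h]
  rw [← ofReal_norm, ← one_div, ← Real.sqrt_eq_rpow, Real.sqrt_sq (norm_nonneg _)]

/-- The filter of those continuous functions that are close to `g` in `L²` of the representing
measures of finitely many vectors. -/
noncomputable def approxFilter (g : X → ℂ) : Filter C(X, ℂ) :=
  Filter.comap (fun f x => eLpNorm (⇑f - g) 2 (vectorMeasure φ x)) (𝓝 0)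

variable {φ}

theorem tendsto_approxFilter {ι : Type*} {l : Filter ι} {u : ι → C(X, ℂ)} {g : X → ℂ} :
    Filter.Tendsto u l (approxFilter φ g) ↔
      ∀ x, Filter.Tendsto (fun i => eLpNorm (⇑(u i) - g) 2 (vectorMeasure φ x)) l (𝓝 0) := by
  rw [approxFilter, Filter.tendsto_comap_iff, tendsto_pi_nhds]
  rfl

theorem tendsto_eLpNorm_approxFilter (g : X → ℂ) (x : H) :
    Filter.Tendsto (fun f : C(X, ℂ) => eLpNorm (⇑f - g) 2 (vectorMeasure φ x))
      (approxFilter φ g) (𝓝 0) :=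
  tendsto_approxFilter.1 Filter.tendsto_id x

/-- One approximant serves all the vectors: continuous functions are dense in L² of the sum of their
measures, which dominates each of them. -/
theorem exists_eLpNorm_sub_le {g : X → ℂ} (hg : IsBoundedMeasurable g) (I : Finset H)
    {δ : ℝ≥0∞} (hδ : δ ≠ 0) :
    ∃ f : C(X, ℂ), ∀ x ∈ I, eLpNorm (⇑f - g) 2 (vectorMeasure φ x) ≤ δ := by
  have hm : MemLp g 2 (∑ x ∈ I, vectorMeasure φ x) := hg.memLp _
  obtain ⟨f, hf, -⟩ := hm.exists_boundedContinuous_eLpNorm_sub_le ENNReal.ofNat_ne_top hδ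
  refine ⟨f.toContinuousMap, fun x hx => ?_⟩
  have hle : vectorMeasure φ x ≤ ∑ x ∈ I, vectorMeasure φ x :=
    Finset.single_le_sum (f := fun x => vectorMeasure φ x) (fun _ _ => Measure.zero_le _) hx
  rw [eLpNorm_sub_comm]
  exact (eLpNorm_mono_measure _ hle).trans hf

theorem approxFilter_neBot {g : X → ℂ} (hg : IsBoundedMeasurable g) :
    (approxFilter φ g).NeBot := by
  rw [approxFilter, Filter.comap_neBot_iff]
  intro t ht
  rw [nhds_pi, Filter.mem_pi] at ht
  obtain ⟨I, hI, s, hs, hst⟩ := ht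
  have h1 : ∀ x : H, ∃ ε : ℝ≥0∞, ε ≠ 0 ∧ Set.Iic ε ⊆ s x := fun x => by
    obtain ⟨ε, hε, hε'⟩ := ENNReal.nhds_zero_basis_Iic.mem_iff.1 (hs x)
    exact ⟨ε, hε.ne', hε'⟩
  choose ε hε hεs using h1
  -- A neighbourhood of 0 in the product constrains finitely many vectors only; the smallest
  -- tolerance is positive, being `⊤` when there are none.
  obtain ⟨f, hf⟩ := exists_eLpNorm_sub_le (φ := φ) hg hI.toFinset (δ := hI.toFinset.inf ε) (by
    rw [← pos_iff_ne_zero, Finset.lt_inf_iff ENNReal.zero_lt_top]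
    exact fun x _ => pos_iff_ne_zero.2 (hε x))
  exact ⟨f, hst fun x hx => hεs x
    ((hf x (hI.mem_toFinset.2 hx)).trans (Finset.inf_le (hI.mem_toFinset.2 hx)))⟩

variable (φ) in
/-- The operator `T` is the value at the bounded measurable function `g` of the extension of `φ`
to bounded measurable functions. -/
def HasExtension (g : X → ℂ) (T : H →L[ℂ] H) : Prop :=
  IsBoundedMeasurable g ∧ ∀ x, Filter.Tendsto (fun f => φ f x) (approxFilter φ g) (𝓝 (T x))

omit [TopologicalSpace X] [CompactSpace X] [T2Space X] [BorelSpace X] in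
theorem eLpNorm_mul_le {g h : X → ℂ} {C : ℝ} (hC : ∀ s, ‖g s‖ ≤ C) (μ : Measure X) :
    eLpNorm (g * h) 2 μ ≤ ENNReal.ofReal C * eLpNorm h 2 μ :=
  eLpNorm_le_mul_eLpNorm_of_ae_le_mul (.of_forall fun s => by
    simpa using mul_le_mul_of_nonneg_right (hC s) (norm_nonneg _)) 2

theorem enorm_map_sub (f k : C(X, ℂ)) (x : H) :
    ‖φ f x - φ k x‖ₑ = eLpNorm (⇑f - ⇑k) 2 (vectorMeasure φ x) := by
  rw [← sub_apply, ← map_sub, ← eLpNorm_coe]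
  rfl

theorem exists_tendsto {g : X → ℂ} (hg : IsBoundedMeasurable g) (x : H) :
    ∃ y, Filter.Tendsto (fun f => φ f x) (approxFilter φ g) (𝓝 y) := by
  have := approxFilter_neBot (φ := φ) hg
  rw [← cauchy_map_iff_exists_tendsto, cauchy_map_iff]
  refine ⟨this, ?_⟩
  rw [uniformity_basis_edist_le.tendsto_right_iff]
  intro ε hε
  have h := ((tendsto_eLpNorm_approxFilter (φ := φ) g x).comp Filter.tendsto_fst).add
    ((tendsto_eLpNorm_approxFilter (φ := φ) g x).comp Filter.tendsto_snd)
  rw [add_zero] at h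
  filter_upwards [h.eventually (ge_mem_nhds hε)] with p hp
  refine le_trans ?_ hp
  simp only [edist_eq_enorm_sub, enorm_map_sub]
  exact eLpNorm_sub_le_add (isBoundedMeasurable_coe _) hg (isBoundedMeasurable_coe _) _

namespace HasExtension

variable {g h : X → ℂ} {T S : H →L[ℂ] H}

/-- Limits along any map into the approximating filter compute the extension. -/
theorem eq_of_tendsto (hT : HasExtension φ g T) {ι : Type*} {l : Filter ι} [l.NeBot]
    {u : ι → C(X, ℂ)} (hu : Filter.Tendsto u l (approxFilter φ g)) {x y : H}
    (h : Filter.Tendsto (fun i => φ (u i) x) l (𝓝 y)) : T x = y :=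
  tendsto_nhds_unique ((hT.2 x).comp hu) h

end HasExtension

/-- The isometry on continuous functions passes to the limit, by the triangle inequality in both
directions. -/
theorem enorm_eq_of_tendsto {g : X → ℂ} (hg : IsBoundedMeasurable g) {x y : H}
    (h : Filter.Tendsto (fun f => φ f x) (approxFilter φ g) (𝓝 y)) :
    ‖y‖ₑ = eLpNorm g 2 (vectorMeasure φ x) := by
  have := approxFilter_neBot (φ := φ) hg
  have h0 := tendsto_eLpNorm_approxFilter (φ := φ) g x
  have h1 : Filter.Tendsto (fun f : C(X, ℂ) => eLpNorm (⇑f) 2 (vectorMeasure φ x))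
      (approxFilter φ g) (𝓝 ‖y‖ₑ) := by
    simpa only [eLpNorm_coe] using h.enorm
  apply le_antisymm
  · have h2 := h0.add_const (eLpNorm g 2 (vectorMeasure φ x))
    rw [zero_add] at h2
    refine le_of_tendsto_of_tendsto' h1 h2 fun f => ?_
    conv_lhs => rw [← sub_add_cancel (⇑f) g]
    exact eLpNorm_add_le ((isBoundedMeasurable_coe f).1.sub hg.1).aestronglyMeasurable
      hg.1.aestronglyMeasurable one_le_two
  · have h2 := h0.add h1
    rw [zero_add] at h2
    refine le_of_tendsto_of_tendsto' tendsto_const_nhds h2 fun f => ?_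
    conv_lhs => rw [← sub_add_cancel g (⇑f)]
    rw [eLpNorm_sub_comm (⇑f)]
    exact eLpNorm_add_le (hg.1.sub (isBoundedMeasurable_coe f).1).aestronglyMeasurable
      (isBoundedMeasurable_coe f).1.aestronglyMeasurable one_le_two

theorem hasExtension_coe (f : C(X, ℂ)) : HasExtension φ f (φ f) := by
  refine ⟨isBoundedMeasurable_coe f, fun x => ?_⟩
  rw [tendsto_iff_edist_tendsto_0]
  simp only [edist_eq_enorm_sub, enorm_map_sub]
  exact tendsto_eLpNorm_approxFilter _ x

/-- The representing measure of `x` has total mass `‖x‖²`. -/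
theorem eLpNorm_one_vectorMeasure (x : H) :
    vectorMeasure φ x Set.univ ^ (1 / 2 : ℝ) = ‖x‖ₑ := by
  have := eLpNorm_coe φ x 1
  rw [map_one, ContinuousMap.coe_one, show (1 : X → ℂ) = fun _ => 1 from rfl,
    eLpNorm_const' _ (by simp) (by simp)] at this
  simpa using this

/-- The maximum with 0 covers empty X, where C may be negative. -/
theorem norm_le_of_enorm_eq {g : X → ℂ} {x y : H}
    (h : ‖y‖ₑ = eLpNorm g 2 (vectorMeasure φ x)) {C : ℝ} (hC : ∀ s, ‖g s‖ ≤ C) :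
    ‖y‖ ≤ max C 0 * ‖x‖ := by
  have := eLpNorm_le_of_ae_bound (p := 2) (μ := vectorMeasure φ x) (.of_forall hC)
  rw [← h, ENNReal.toReal_ofNat, ← one_div, eLpNorm_one_vectorMeasure, ← ofReal_norm,
    ← ofReal_norm, ← ENNReal.ofReal_mul (norm_nonneg _)] at this
  rw [mul_comm]
  refine (ENNReal.ofReal_le_ofReal_iff (by positivity)).1 (this.trans ?_)
  gcongr
  exact le_max_left _ _

/-- The approximating filter does not depend on the vector, so the pointwise limits are linear in
it. -/
theorem exists_hasExtension {g : X → ℂ} (hg : IsBoundedMeasurable g) :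
    ∃ T, HasExtension φ g T := by
  have := approxFilter_neBot (φ := φ) hg
  choose T hT using exists_tendsto (φ := φ) hg
  have hlim : Filter.Tendsto (fun f x => φ f x) (approxFilter φ g) (𝓝 T) :=
    tendsto_pi_nhds.2 hT
  obtain ⟨C, hC⟩ := hg.2
  let L : H →ₗ[ℂ] H :=
    { toFun := T
      map_add' := fun x y => tendsto_nhds_unique (hT (x + y))
        (by simpa using (hT x).add (hT y))
      map_smul' := fun c x => tendsto_nhds_unique (hT (c • x))
        (by simpa using (hT x).const_smul c) }
  exact ⟨L.mkContinuous (max C 0) fun x => norm_le_of_enorm_eq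
    (enorm_eq_of_tendsto hg (hT x)) hC, hg, hT⟩

namespace HasExtension

variable {g h : X → ℂ} {T S : H →L[ℂ] H}

theorem enorm_apply (hT : HasExtension φ g T) (x : H) :
    ‖T x‖ₑ = eLpNorm g 2 (vectorMeasure φ x) :=
  enorm_eq_of_tendsto hT.1 (hT.2 x)

theorem unique (hT : HasExtension φ g T) (hS : HasExtension φ g S) : T = S := by
  have := approxFilter_neBot (φ := φ) hT.1
  exact ContinuousLinearMap.ext fun x => tendsto_nhds_unique (hT.2 x) (hS.2 x)

theorem add (hT : HasExtension φ g T) (hS : HasExtension φ h S) :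
    HasExtension φ (g + h) (T + S) := by
  have := approxFilter_neBot (φ := φ) hT.1
  have := approxFilter_neBot (φ := φ) hS.1
  obtain ⟨R, hR⟩ := exists_hasExtension (φ := φ) (hT.1.add hS.1)
  have hu : Filter.Tendsto (fun p : C(X, ℂ) × C(X, ℂ) => p.1 + p.2)
      (approxFilter φ g ×ˢ approxFilter φ h) (approxFilter φ (g + h)) := by
    refine tendsto_approxFilter.2 fun x => ?_
    have h0 := ((tendsto_eLpNorm_approxFilter (φ := φ) g x).comp Filter.tendsto_fst).add
      ((tendsto_eLpNorm_approxFilter (φ := φ) h x).comp Filter.tendsto_snd)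
    rw [add_zero] at h0
    refine tendsto_of_tendsto_of_tendsto_of_le_of_le tendsto_const_nhds h0
      (fun _ => zero_le) fun p => ?_
    rw [ContinuousMap.coe_add, add_sub_add_comm]
    exact eLpNorm_add_le ((isBoundedMeasurable_coe _).1.sub hT.1.1).aestronglyMeasurable
      ((isBoundedMeasurable_coe _).1.sub hS.1.1).aestronglyMeasurable one_le_two
  have : R = T + S := ContinuousLinearMap.ext fun x => hR.eq_of_tendsto hu (by
    simpa using ((hT.2 x).comp Filter.tendsto_fst).add ((hS.2 x).comp Filter.tendsto_snd))
  exact this ▸ hR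

/-- A bounded multiplication operator transports the approximating filters. -/
theorem tendsto_mul (f : C(X, ℂ)) (g : X → ℂ) :
    Filter.Tendsto (fun k => f * k) (approxFilter φ g) (approxFilter φ (⇑f * g)) := by
  refine tendsto_approxFilter.2 fun x => ?_
  have h0 := ENNReal.Tendsto.const_mul (a := ENNReal.ofReal ‖f‖)
    (tendsto_eLpNorm_approxFilter (φ := φ) g x) (.inr ENNReal.ofReal_ne_top)
  rw [mul_zero] at h0
  refine tendsto_of_tendsto_of_tendsto_of_le_of_le tendsto_const_nhds h0
    (fun _ => zero_le) fun k => ?_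
  rw [ContinuousMap.coe_mul, ← mul_sub]
  exact eLpNorm_mul_le f.norm_coe_le_norm _

theorem coe_mul (f : C(X, ℂ)) (hT : HasExtension φ g T) :
    HasExtension φ (⇑f * g) (φ f * T) := by
  have := approxFilter_neBot (φ := φ) hT.1
  obtain ⟨R, hR⟩ := exists_hasExtension (φ := φ) ((isBoundedMeasurable_coe f).mul hT.1)
  have : R = φ f * T := ContinuousLinearMap.ext fun x => hR.eq_of_tendsto (tendsto_mul f g) (by
    simpa [Function.comp_def] using ((φ f).continuous.tendsto _).comp (hT.2 x))
  exact this ▸ hR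

theorem smul (c : ℂ) (hT : HasExtension φ g T) : HasExtension φ (c • g) (c • T) := by
  have := hT.coe_mul (algebraMap ℂ C(X, ℂ) c)
  rw [AlgHomClass.commutes, ← Algebra.smul_def] at this
  convert this using 1
  ext s
  simp

theorem sub (hT : HasExtension φ g T) (hS : HasExtension φ h S) :
    HasExtension φ (g - h) (T - S) := by
  simpa [← sub_eq_add_neg] using hT.add (hS.smul (-1))

theorem enorm_sub_apply (hT : HasExtension φ g T) (hS : HasExtension φ h S) (x : H) :
    ‖T x - S x‖ₑ = eLpNorm (g - h) 2 (vectorMeasure φ x) := by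
  simpa using (hT.sub hS).enorm_apply x

theorem mul (hT : HasExtension φ g T) (hS : HasExtension φ h S) :
    HasExtension φ (g * h) (T * S) := by
  have := approxFilter_neBot (φ := φ) hT.1
  obtain ⟨R, hR⟩ := exists_hasExtension (φ := φ) (hT.1.mul hS.1)
  have : T * S = R := ContinuousLinearMap.ext fun x => by
    -- The filter of g also controls the measure of the vector Sx, so φ(f)Sx tends to TSx. Its
    -- distance to Rx is the norm of (f - g)h in L²(μ_x), which tends to 0 as h is bounded.
    refine tendsto_nhds_unique (hT.2 (S x)) ?_
    rw [tendsto_iff_edist_tendsto_0]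
    obtain ⟨C, hC⟩ := hS.1.2
    have h0 := ENNReal.Tendsto.const_mul (a := ENNReal.ofReal C)
      (tendsto_eLpNorm_approxFilter (φ := φ) g x) (.inr ENNReal.ofReal_ne_top)
    rw [mul_zero] at h0
    refine tendsto_of_tendsto_of_tendsto_of_le_of_le tendsto_const_nhds h0
      (fun _ => zero_le) fun f => ?_
    rw [edist_eq_enorm_sub, ← mul_apply_eq_comp, (coe_mul f hS).enorm_sub_apply hR,
      ← sub_mul, mul_comm]
    exact eLpNorm_mul_le hC _
  exact this ▸ hR

theorem star (hT : HasExtension φ g T) : HasExtension φ (star g) (star T) := by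
  have := approxFilter_neBot (φ := φ) hT.1
  obtain ⟨R, hR⟩ := exists_hasExtension (φ := φ) hT.1.star
  have hu : Filter.Tendsto (fun f => Star.star f) (approxFilter φ g)
      (approxFilter φ (Star.star g)) := by
    refine tendsto_approxFilter.2 fun x => ?_
    convert tendsto_eLpNorm_approxFilter (φ := φ) g x using 2 with f
    refine eLpNorm_congr_norm_ae (.of_forall fun s => ?_)
    simp [← map_sub]
  have : R = Star.star T := by
    rw [ContinuousLinearMap.star_eq_adjoint, ContinuousLinearMap.eq_adjoint_iff]
    intro x y
    refine tendsto_nhds_unique (((hR.2 x).comp hu).inner tendsto_const_nhds)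
      ((tendsto_const_nhds.inner (hT.2 y)).congr fun f => ?_)
    rw [Function.comp_apply, map_star, ContinuousLinearMap.star_eq_adjoint,
      ContinuousLinearMap.adjoint_inner_left]
  exact this ▸ hR

theorem sum {ι : Type*} (I : Finset ι) {g : ι → X → ℂ} {T : ι → H →L[ℂ] H}
    (hT : ∀ i ∈ I, HasExtension φ (g i) (T i)) : HasExtension φ (∑ i ∈ I, g i) (∑ i ∈ I, T i) := by
  classical
  induction I using Finset.induction_on with
  | empty => simpa using hasExtension_coe (φ := φ) 0
  | insert i I hi ih =>
    rw [Finset.sum_insert hi, Finset.sum_insert hi]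
    exact (hT i (by simp)).add (ih fun j hj => hT j (by simp [hj]))

theorem commute (hT : HasExtension φ g T) (hS : ∀ f, S * φ f = φ f * S) : S * T = T * S := by
  have := approxFilter_neBot (φ := φ) hT.1
  refine ContinuousLinearMap.ext fun x => ?_
  refine tendsto_nhds_unique (((S.continuous.tendsto _).comp (hT.2 x)).congr fun f => ?_)
    (hT.2 (S x))
  exact congrArg (· x) (hS f)

end HasExtension

end SpectralConstruction

/-! ### Step functions and integrals against a spectral measure. -/

namespace SpectralConstruction

/-- Bounded measurable functions are uniform limits of simple functions. -/
theorem IsBoundedMeasurable.exists_simpleFunc {Ω : Type*} [MeasurableSpace Ω] {g : Ω → ℂ}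
    (hg : IsBoundedMeasurable g) {ε : ℝ} (hε : 0 < ε) :
    ∃ h : SimpleFunc Ω ℂ, ∀ s, ‖g s - h s‖ ≤ ε := by
  obtain ⟨hm, C, hC⟩ := hg
  obtain ⟨t, ht⟩ := (isCompact_closedBall (0 : ℂ) C).elim_finite_subcover
    (fun n => Metric.ball (TopologicalSpace.denseSeq ℂ n) ε) (fun _ => Metric.isOpen_ball)
    (fun z _ => by
      obtain ⟨n, hn⟩ := (TopologicalSpace.denseRange_denseSeq ℂ).exists_dist_lt z hε
      exact Set.mem_iUnion.2 ⟨n, hn⟩)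
  -- By compactness finitely many balls cover the values of g; `t.sup id` is large enough an index
  -- to include all their centres.
  refine ⟨(SimpleFunc.nearestPt (TopologicalSpace.denseSeq ℂ) (t.sup id)).comp g hm, fun s => ?_⟩
  have hs := ht (mem_closedBall_zero_iff.2 (hC s))
  simp only [Set.mem_iUnion] at hs
  obtain ⟨n, hn, hs⟩ := hs
  have h := SimpleFunc.edist_nearestPt_le (TopologicalSpace.denseSeq ℂ) (g s)
    (Finset.le_sup (f := id) hn)
  rw [edist_dist, edist_dist, ENNReal.ofReal_le_ofReal_iff dist_nonneg] at h
  rw [← dist_eq_norm, dist_comm]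
  rw [Metric.mem_ball, dist_comm] at hs
  exact h.trans hs.le

end SpectralConstruction

open SpectralConstruction

namespace SpectralMeasure

variable {Ω : Type*} [MeasurableSpace Ω] {H : Type*}
  [NormedAddCommGroup H] [InnerProductSpace ℂ H] [CompleteSpace H] {P Q : SpectralMeasure Ω H}

theorem inner_toFun (P : SpectralMeasure Ω H) (ω : {ω : Set Ω // MeasurableSet ω}) (x : H) :
    inner ℂ x (P.toFun ω x) = ((P.measure x).real ω : ℂ) := by
  have h : inner ℂ x (P.toFun ω x) = ((‖P.toFun ω x‖ ^ 2 : ℝ) : ℂ) := by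
    conv_lhs => rw [← (P.isStarProjection' ω).isIdempotentElem]
    rw [mul_apply_eq_comp, ← ContinuousLinearMap.adjoint_inner_left,
      (P.isStarProjection' ω).isSelfAdjoint.adjoint_eq, inner_self_eq_norm_sq_to_K]
    simp
  have h' : inner ℂ (P.toFun ω x) x = ((‖P.toFun ω x‖ ^ 2 : ℝ) : ℂ) := by
    rw [← inner_conj_symm, h, Complex.conj_ofReal]
  rw [h, measureReal_def, P.measure_apply x ω.2, h', RCLike.re_to_complex, Complex.ofReal_re,
    ENNReal.toReal_ofReal (by positivity)]

instance (P : SpectralMeasure Ω H) (x : H) : IsFiniteMeasure (P.measure x) :=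
  ⟨by rw [P.measure_apply x MeasurableSet.univ]; exact ENNReal.ofReal_lt_top⟩

/-- Complex polarization: an operator is determined by its quadratic form. -/
theorem ext_of_measure (h : ∀ x, P.measure x = Q.measure x) : P = Q := by
  have : P.toFun = Q.toFun := by
    ext1 ω
    rw [← ContinuousLinearMap.coe_inj, ← ext_inner_map]
    intro x
    rw [ContinuousLinearMap.coe_coe, ContinuousLinearMap.coe_coe, ← inner_conj_symm,
      ← inner_conj_symm (Q.toFun ω x), inner_toFun, inner_toFun, h]
  cases P
  cases Q
  congr

theorem inner_stepIntegral (P : SpectralMeasure Ω H) (h : SimpleFunc Ω ℂ) (x : H) :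
    inner ℂ x (P.stepIntegral h x) = ∫ s, h s ∂(P.measure x) := by
  rw [← SimpleFunc.integral_eq_integral h (SimpleFunc.integrable_of_isFiniteMeasure h),
    SimpleFunc.integral_eq]
  simp [stepIntegral, inner_toFun, mul_comm]

namespace HasNormIntegral

variable {f : Ω → ℂ} {T : H →L[ℂ] H}

theorem exists_simpleFunc (hT : P.HasNormIntegral f T) {ε : ℝ} (hε : 0 < ε) :
    ∃ h : SimpleFunc Ω ℂ, (∀ s, ‖f s - h s‖ ≤ ε) ∧ ‖T - P.stepIntegral h‖ ≤ ε := by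
  obtain ⟨h, hh⟩ := IsBoundedMeasurable.exists_simpleFunc ⟨hT.1, hT.2.1⟩ hε
  exact ⟨h, hh, (hT.2.2 h).trans (Real.iSup_le hh hε.le)⟩

theorem mem_closure (hT : P.HasNormIntegral f T) : T ∈ closure (Set.range P.stepIntegral) := by
  refine Metric.mem_closure_iff.2 fun ε hε => ?_
  obtain ⟨h, -, hh⟩ := hT.exists_simpleFunc (half_pos hε)
  exact ⟨_, ⟨h, rfl⟩, by rw [dist_eq_norm]; linarith⟩

theorem mem_centralizer_centralizer (hT : P.HasNormIntegral f T) :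
    T ∈ Set.centralizer (Set.centralizer (Set.range P.toFun)) := by
  refine closure_minimal ?_ (Set.isClosed_centralizer _) hT.mem_closure
  rintro _ ⟨h, rfl⟩ S hS
  simp only [stepIntegral, Finset.mul_sum, Finset.sum_mul]
  refine Finset.sum_congr rfl fun α _ => ?_
  rw [mul_smul_comm, smul_mul_assoc, hS _ ⟨_, rfl⟩]

theorem inner_eq_integral (hT : P.HasNormIntegral f T) (x : H) :
    inner ℂ x (T x) = ∫ s, f s ∂(P.measure x) := by
  have hf : Integrable f (P.measure x) := by
    obtain ⟨C, hC⟩ := hT.2.1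
    exact Integrable.of_bound hT.1.aestronglyMeasurable C (.of_forall hC)
  refine eq_of_forall_dist_le fun ε hε => ?_
  -- K collects the factors of the two error terms; dividing by K + 1 below avoids division by zero.
  set K := ‖x‖ ^ 2 + (P.measure x).real Set.univ with hK
  have hK0 : 0 ≤ K := by positivity
  obtain ⟨h, hh, hTh⟩ := hT.exists_simpleFunc (ε := ε / (K + 1)) (by positivity)
  have h1 : ‖inner ℂ x (T x) - inner ℂ x (P.stepIntegral h x)‖ ≤ ε / (K + 1) * ‖x‖ ^ 2 := by
    rw [← inner_sub_right, ← sub_apply]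
    calc _ ≤ ‖x‖ * (‖T - P.stepIntegral h‖ * ‖x‖) :=
          (norm_inner_le_norm _ _).trans (by gcongr; exact ContinuousLinearMap.le_opNorm _ _)
      _ ≤ ‖x‖ * (ε / (K + 1) * ‖x‖) := by gcongr
      _ = _ := by ring
  have h2 : ‖∫ s, f s ∂(P.measure x) - ∫ s, h s ∂(P.measure x)‖ ≤
      ε / (K + 1) * (P.measure x).real Set.univ := by
    rw [← integral_sub hf (SimpleFunc.integrable_of_isFiniteMeasure h)]
    exact norm_integral_le_of_norm_le_const (.of_forall hh)
  rw [inner_stepIntegral] at h1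
  calc _ ≤ _ := dist_triangle_right _ _ (∫ s, h s ∂(P.measure x))
    _ ≤ ε / (K + 1) * ‖x‖ ^ 2 + ε / (K + 1) * (P.measure x).real Set.univ := by
      rw [dist_eq_norm, dist_eq_norm]; exact add_le_add h1 h2
    _ = ε / (K + 1) * K := by rw [hK]; ring
    _ ≤ ε / (K + 1) * (K + 1) := by gcongr; linarith
    _ = ε := by field_simp

end HasNormIntegral

end SpectralMeasure

/-! ### The spectral measure of a representation of C(X). -/

namespace SpectralConstruction

variable {X : Type*} [TopologicalSpace X] [CompactSpace X] [T2Space X] [MeasurableSpace X]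
  [BorelSpace X] {H : Type*} [NormedAddCommGroup H] [InnerProductSpace ℂ H] [CompleteSpace H]
  (φ : C(X, ℂ) →⋆ₐ[ℂ] (H →L[ℂ] H))

/-- The spectral projection of a Borel set. -/
noncomputable def proj (ω : Set X) (hω : MeasurableSet ω) : H →L[ℂ] H :=
  (exists_hasExtension (φ := φ) (.indicator_one hω)).choose

theorem hasExtension_proj (ω : Set X) (hω : MeasurableSet ω) :
    HasExtension φ (ω.indicator 1) (proj φ ω hω) :=
  (exists_hasExtension (φ := φ) (.indicator_one hω)).choose_spec

theorem isStarProjection_proj (ω : Set X) (hω : MeasurableSet ω) :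
    IsStarProjection (proj φ ω hω) := by
  have h := hasExtension_proj φ ω hω
  constructor
  · refine (h.mul h).unique ?_
    convert h using 1
    ext s
    by_cases hs : s ∈ ω <;> simp [hs]
  · refine h.star.unique ?_
    convert h using 1
    ext s
    by_cases hs : s ∈ ω <;> simp [hs]

theorem vectorMeasure_eq (x : H) (ω : Set X) (hω : MeasurableSet ω) :
    vectorMeasure φ x ω = ENNReal.ofReal (RCLike.re (inner ℂ (proj φ ω hω x) x)) := by
  have hp := isStarProjection_proj φ ω hω
  have h : inner ℂ (proj φ ω hω x) x = ((‖proj φ ω hω x‖ ^ 2 : ℝ) : ℂ) := by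
    conv_lhs => rw [← hp.isIdempotentElem]
    rw [mul_apply_eq_comp, ← ContinuousLinearMap.adjoint_inner_right, hp.isSelfAdjoint.adjoint_eq,
      inner_self_eq_norm_sq_to_K]
    simp
  have h1 := (hasExtension_proj φ ω hω).enorm_apply x
  rw [show (1 : X → ℂ) = fun _ => 1 from rfl, eLpNorm_indicator_const hω (by simp) (by simp)] at h1
  rw [h, RCLike.re_to_complex, Complex.ofReal_re, ENNReal.ofReal_pow (norm_nonneg _), ofReal_norm,
    h1]
  rw [ENNReal.toReal_ofNat, enorm_one, one_mul, ← ENNReal.rpow_natCast, ← ENNReal.rpow_mul]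
  norm_num

variable {φ} {Ω : Type*} [TopologicalSpace Ω] [MeasurableSpace Ω] [BorelSpace Ω] {e : Ω → X}

/-- The spectral measure of `φ`, restricted to an open subset that carries it. -/
noncomputable def spectralMeasure (he : Topology.IsOpenEmbedding e)
    (h1 : HasExtension φ ((Set.range e).indicator 1) 1) : SpectralMeasure Ω H where
  toFun ω := proj φ (e '' ω) (he.measurableEmbedding.measurableSet_image.2 ω.2)
  isStarProjection' ω := isStarProjection_proj φ _ _
  map_univ' := (hasExtension_proj φ _ _).unique (by simpa using h1)
  exists_measure' x := ⟨(vectorMeasure φ x).comap e, fun ω => by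
    rw [he.measurableEmbedding.comap_apply]
    exact vectorMeasure_eq φ x _ _⟩

theorem hasExtension_toFun (he : Topology.IsOpenEmbedding e)
    (h1 : HasExtension φ ((Set.range e).indicator 1) 1) (ω : {ω : Set Ω // MeasurableSet ω}) :
    HasExtension φ ((e '' ω).indicator 1) ((spectralMeasure he h1).toFun ω) :=
  hasExtension_proj φ _ (he.measurableEmbedding.measurableSet_image.2 ω.2)

theorem spectralMeasure_measure (he : Topology.IsOpenEmbedding e)
    (h1 : HasExtension φ ((Set.range e).indicator 1) 1) (x : H) :
    (spectralMeasure he h1).measure x = (vectorMeasure φ x).comap e := by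
  ext ω hω
  rw [he.measurableEmbedding.comap_apply, SpectralMeasure.measure_apply _ _ hω]
  exact (vectorMeasure_eq φ x _ (he.measurableEmbedding.measurableSet_image.2 hω)).symm

theorem isResolutionOfIdentity_spectralMeasure [Nonempty Ω] (he : Topology.IsOpenEmbedding e)
    (h1 : HasExtension φ ((Set.range e).indicator 1) 1) :
    (spectralMeasure he h1).IsResolutionOfIdentity := by
  refine ⟨inferInstance, he.locallyCompactSpace, he.isEmbedding.t2Space, fun x => ?_⟩
  rw [spectralMeasure_measure]
  refine ⟨fun ω hω r hr => ?_⟩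
  rw [he.measurableEmbedding.comap_apply] at hr
  obtain ⟨K, hKω, hK, hrK⟩ := Measure.InnerRegular.innerRegular
    (he.measurableEmbedding.measurableSet_image.2 hω) r hr
  refine ⟨e ⁻¹' K, ?_, ?_, ?_⟩
  · rw [← he.injective.preimage_image ω]
    exact Set.preimage_mono hKω
  · exact he.isInducing.isCompact_preimage' hK (hKω.trans (Set.image_subset_range _ _))
  · rwa [he.measurableEmbedding.comap_apply, Set.image_preimage_eq_of_subset
      (hKω.trans (Set.image_subset_range _ _))]

theorem hasNormIntegral_spectralMeasure (he : Topology.IsOpenEmbedding e)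
    (h1 : HasExtension φ ((Set.range e).indicator 1) 1) (f : C(X, ℂ)) :
    (spectralMeasure he h1).HasNormIntegral (f ∘ e) (φ f) := by
  refine ⟨f.continuous.measurable.comp he.continuous.measurable,
    ⟨‖f‖, fun s => f.norm_coe_le_norm _⟩, fun h => ?_⟩
  have hS : HasExtension φ (∑ α ∈ h.range, α • (e '' (h ⁻¹' {α})).indicator 1)
      ((spectralMeasure he h1).stepIntegral h) :=
    HasExtension.sum _ fun α _ =>
      (hasExtension_toFun he h1 ⟨h ⁻¹' {α}, h.measurableSet_fiber α⟩).smul α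
  have hval : ∀ s, (∑ α ∈ h.range, α • (e '' (h ⁻¹' {α})).indicator (1 : X → ℂ)) (e s) = h s := by
    intro s
    rw [Finset.sum_apply, Finset.sum_eq_single (h s)]
    · simp [he.injective.eq_iff]
    · intro α _ hα
      simp [he.injective.eq_iff, hα.symm]
    · simp
  -- Multiplying by the identity, as the extension of the indicator of the range of e, discards the
  -- values of f off that range, which the supremum over Ω does not bound.
  have hT' := ((hasExtension_coe (φ := φ) f).sub hS).mul h1
  rw [mul_one] at hT'
  have hbdd : BddAbove (Set.range fun s => ‖(f ∘ e) s - h s‖) := by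
    obtain ⟨C, hC⟩ := h.exists_forall_norm_le
    exact ⟨‖f‖ + C, by
      rintro _ ⟨s, rfl⟩
      exact (norm_sub_le _ _).trans (add_le_add (f.norm_coe_le_norm _) (hC s))⟩
  have h0 : 0 ≤ ⨆ s, ‖(f ∘ e) s - h s‖ := Real.iSup_nonneg fun _ => norm_nonneg _
  refine ContinuousLinearMap.opNorm_le_bound _ h0 fun x => ?_
  have := norm_le_of_enorm_eq (hT'.enorm_apply x) (C := ⨆ s, ‖(f ∘ e) s - h s‖) fun t => by
    by_cases ht : t ∈ Set.range e
    · obtain ⟨s, rfl⟩ := ht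
      refine le_trans (le_of_eq ?_) (le_ciSup hbdd s)
      rw [Pi.mul_apply, Pi.sub_apply, hval]
      simp
    · simpa [ht] using h0
  rwa [max_eq_left h0] at this

/-- Inner regularity survives the push-forward along e, so Riesz uniqueness on X identifies the
pushed measures with the vector measures; pulling back along e recovers the originals. -/
theorem eq_spectralMeasure (he : Topology.IsOpenEmbedding e)
    (h1 : HasExtension φ ((Set.range e).indicator 1) 1) {Q : SpectralMeasure Ω H}
    (hQ : Q.IsResolutionOfIdentity)
    (h : ∀ (f : C(X, ℂ)) (x : H), ∫ s, f (e s) ∂(Q.measure x) = inner ℂ x (φ f x)) :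
    Q = spectralMeasure he h1 := by
  refine SpectralMeasure.ext_of_measure fun x => ?_
  have := hQ.2.2.2 x
  have : ((Q.measure x).map e).InnerRegular :=
    Measure.InnerRegular.map_of_continuous he.continuous
  have hmap : (Q.measure x).map e = vectorMeasure φ x := by
    refine Measure.ext_of_integral_eq_on_compactlySupported fun f => ?_
    have hf := integral_vectorMeasure φ x (f : C(X, ℝ))
    have hf' := h (f : C(X, ℝ)).complexify x
    rw [he.measurableEmbedding.integral_map]
    rw [← inner_conj_symm, ← hf'] at hf
    refine Eq.trans ?_ hf.symm
    simp only [ContinuousMap.complexify_apply]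
    rw [integral_complex_ofReal]
    simp
  rw [spectralMeasure_measure, ← hmap, he.measurableEmbedding.comap_map]

theorem isSupport_spectralMeasure (he : Topology.IsOpenEmbedding e)
    (h1 : HasExtension φ ((Set.range e).indicator 1) 1)
    (hφ : ∀ f : C(X, ℂ), (∀ s ∉ Set.range e, f s = 0) → φ f = 0 → f = 0) :
    (spectralMeasure he h1).IsSupport Set.univ := by
  refine ⟨⟨by simp, ?_⟩, ?_⟩
  · refine (hasExtension_toFun he h1 _).unique ?_
    simp only [Set.compl_univ, Set.image_empty, Set.indicator_empty']
    simpa using hasExtension_coe (φ := φ) 0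
  · rintro U ⟨hU, hPU⟩ s hs
    exfalso
    obtain ⟨f, hf0, hf1, -⟩ := exists_continuous_zero_one_of_isClosed
      (he.isOpenMap U hU).isClosed_compl (isClosed_singleton (x := e s))
      (Set.disjoint_singleton_right.2 fun h => h ⟨s, hs, rfl⟩)
    have hf := (hasExtension_coe (φ := φ) f.complexify).mul (hasExtension_proj φ (e '' U)
      (he.isOpenMap U hU).measurableSet)
    -- The Urysohn function f vanishes off e(U), hence equals its product with the indicator of
    -- e(U), whose projection is 0.
    have hz : φ f.complexify = 0 := by
      refine (hasExtension_coe (φ := φ) f.complexify).unique ?_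
      have hPU' : proj φ (e '' U) (he.isOpenMap U hU).measurableSet = 0 := hPU
      rw [hPU', mul_zero] at hf
      convert hf using 1
      ext t
      by_cases ht : t ∈ e '' U
      · simp [ht]
      · have : f t = 0 := hf0 ht
        simp [this]
    have := hφ f.complexify (fun t ht => by
      have : f t = 0 := hf0 fun ht' => ht (Set.image_subset_range _ _ ht')
      simp [this]) hz
    have h2 : f (e s) = 1 := hf1 rfl
    have h3 := DFunLike.congr_fun this (e s)
    simp [h2] at h3

end SpectralConstruction

/-! ### The spectrum as an open set of characters of the unitization. -/

namespace SpectralConstruction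

section Characters

variable {A : Type*} [NonUnitalRing A] [Module ℂ A] {B : Type*} [NonUnitalCommCStarAlgebra B]
  (ι : A →ₙₐ[ℂ] B)

variable (B) in
/-- The characters of the unitization: the compactified character space. -/
abbrev UnitizedSpectrum : Type _ := WeakDual.characterSpace ℂ (Unitization ℂ B)

noncomputable instance : MeasurableSpace (UnitizedSpectrum B) := borel _

instance : BorelSpace (UnitizedSpectrum B) := ⟨rfl⟩

/-- The multiplicative functionals on `A` that factor through `ι`. -/
def spectrumVia : Set (A →ₙₐ[ℂ] ℂ) :=
  (fun τ : B →ₙₐ[ℂ] ℂ => τ.comp ι) '' multFunctionals B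

variable {ι}

/-- The unital extension of a multiplicative functional. -/
noncomputable def toUnitizedSpectrum (σ : spectrumVia ι) : UnitizedSpectrum B :=
  WeakDual.CharacterSpace.equivAlgHom.symm (Unitization.lift σ.2.choose)

theorem toUnitizedSpectrum_inr (σ : spectrumVia ι) (b : B) :
    toUnitizedSpectrum σ (b : Unitization ℂ B) = σ.2.choose b := by
  rw [toUnitizedSpectrum, WeakDual.CharacterSpace.equivAlgHom_symm_coe]
  simp

theorem toUnitizedSpectrum_apply (σ : spectrumVia ι) (a : A) :
    toUnitizedSpectrum σ (ι a : Unitization ℂ B) = (σ : A →ₙₐ[ℂ] ℂ) a := by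
  rw [toUnitizedSpectrum_inr]
  exact DFunLike.congr_fun σ.2.choose_spec.2 a

theorem apply_inl (χ : UnitizedSpectrum B) (r : ℂ) : χ (Unitization.inl r) = r :=
  AlgHomClass.commutes χ r

theorem range_toUnitizedSpectrum (hι : DenseRange ι) :
    Set.range (toUnitizedSpectrum (ι := ι)) =
      {χ | ∃ b : B, χ (b : Unitization ℂ B) ≠ 0} := by
  ext χ
  constructor
  · rintro ⟨σ, rfl⟩
    simp only [Set.mem_ofPred_eq, toUnitizedSpectrum_inr]
    by_contra! h
    exact σ.2.choose_spec.1 (NonUnitalAlgHom.ext h)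
  · rintro ⟨b, hb⟩
    let τ : B →ₙₐ[ℂ] ℂ := Unitization.lift.symm (WeakDual.CharacterSpace.equivAlgHom χ)
    have hτ : τ ∈ multFunctionals B := fun h => hb (DFunLike.congr_fun h b)
    refine ⟨⟨τ.comp ι, τ, hτ, rfl⟩, ?_⟩
    set χ' := toUnitizedSpectrum (ι := ι) ⟨τ.comp ι, τ, hτ, rfl⟩
    have h : ∀ b : B, χ' (b : Unitization ℂ B) = χ (b : Unitization ℂ B) := by
      refine fun b => congrFun (hι.equalizer (g := fun b : B => χ' (b : Unitization ℂ B))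
        (h := fun b : B => χ (b : Unitization ℂ B)) ?_ ?_ ?_) b
      · exact (map_continuous χ').comp Unitization.isometry_inr.continuous
      · exact (map_continuous χ).comp Unitization.isometry_inr.continuous
      · ext a
        exact toUnitizedSpectrum_apply _ a
    refine WeakDual.CharacterSpace.ext fun u => ?_
    induction u with
    | inl_add_inr r b => rw [map_add, map_add, apply_inl, apply_inl, h]

theorem continuous_toUnitizedSpectrum (hι : DenseRange ι) :
    Continuous (toUnitizedSpectrum (ι := ι)) := by
  have h : ∀ b : B, Continuous fun σ : spectrumVia ι =>
      toUnitizedSpectrum σ (b : Unitization ℂ B) := by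
    intro b
    -- The weak* topology controls evaluations on the image of A only. Characters are contractive,
    -- so evaluation at b is a uniform limit of these.
    refine continuous_of_uniform_approx_of_continuous fun V hV => ?_
    obtain ⟨ε, hε, hV⟩ := Metric.mem_uniformity_dist.1 hV
    obtain ⟨a, ha⟩ := hι.exists_dist_lt b hε
    refine ⟨fun σ => toUnitizedSpectrum σ (ι a : Unitization ℂ B), ?_, fun σ => hV ?_⟩
    · simp only [toUnitizedSpectrum_apply]
      exact ((continuous_apply a).comp continuous_induced_dom).comp continuous_subtype_val
    · rw [dist_eq_norm, ← map_sub]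
      refine (AlgHom.norm_apply_le_self _ _).trans_lt ?_
      rwa [← dist_eq_norm, Unitization.isometry_inr.dist_eq]
  refine Continuous.subtype_mk (WeakDual.continuous_of_continuous_eval fun u => ?_) _
  induction u with
  | inl_add_inr r b =>
    refine ((continuous_const (y := r)).add (h b)).congr fun σ => ?_
    have := map_add (toUnitizedSpectrum σ) (Unitization.inl r) (b : Unitization ℂ B)
    rw [apply_inl] at this
    exact this.symm

theorem isOpenEmbedding_toUnitizedSpectrum (hι : DenseRange ι) :
    Topology.IsOpenEmbedding (toUnitizedSpectrum (ι := ι)) := by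
  refine ⟨?_, ?_⟩
  · let g : UnitizedSpectrum B → A → ℂ := fun χ a => χ (ι a : Unitization ℂ B)
    have hg : Continuous g := continuous_pi fun a =>
      (WeakDual.eval_continuous _).comp continuous_subtype_val
    refine Topology.IsEmbedding.of_comp (continuous_toUnitizedSpectrum hι) hg ?_
    have hge : g ∘ toUnitizedSpectrum (ι := ι) =
        (fun (τ : A →ₙₐ[ℂ] ℂ) (a : A) => τ a) ∘ Subtype.val := by
      ext σ a
      exact toUnitizedSpectrum_apply σ a
    rw [hge]
    exact Topology.IsEmbedding.comp ⟨⟨rfl⟩, DFunLike.coe_injective⟩ .subtypeVal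
  · rw [range_toUnitizedSpectrum hι, Set.ofPred_exists]
    exact isOpen_iUnion fun b => isOpen_ne_fun
      ((WeakDual.eval_continuous _).comp continuous_subtype_val) continuous_const

/-- Characters of a C⋆-algebra preserve the star automatically; density of the image of A keeps them
non-zero after restriction. -/
theorem spectrumVia_subset_hermitian [Star A] (hι : DenseRange ι)
    (hstar : ∀ a, ι (star a) = star (ι a)) : spectrumVia ι ⊆ hermitianMultFunctionals A := by
  intro σ hσ
  have he := toUnitizedSpectrum_apply ⟨σ, hσ⟩
  refine ⟨fun h => ?_, fun a => ?_⟩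
  · have : toUnitizedSpectrum ⟨σ, hσ⟩ ∈ Set.range (toUnitizedSpectrum (ι := ι)) := ⟨_, rfl⟩
    rw [range_toUnitizedSpectrum hι] at this
    obtain ⟨b, hb⟩ := this
    refine hb (congrFun (hι.equalizer (g := fun b : B => toUnitizedSpectrum ⟨σ, hσ⟩
      (b : Unitization ℂ B)) (h := fun _ => 0) ?_ continuous_const ?_) b)
    · exact (map_continuous (toUnitizedSpectrum ⟨σ, hσ⟩)).comp Unitization.isometry_inr.continuous
    · ext a
      exact (he a).trans (DFunLike.congr_fun h a)
  · rw [← he, ← he, hstar, Unitization.inr_star, map_star]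

end Characters

/-! ### The spectral theorem for a commutative C⋆-algebra. -/

section Representation

variable {A : Type*} [NonUnitalRing A] [Module ℂ A] {B : Type*} [NonUnitalCommCStarAlgebra B]
  {ι : A →ₙₐ[ℂ] B} {H : Type*} [NormedAddCommGroup H] [InnerProductSpace ℂ H] [CompleteSpace H]
  (ρ : B →⋆ₙₐ[ℂ] (H →L[ℂ] H))

/-- The functional calculus of a representation on the unitized spectrum. -/
noncomputable def functionalCalculus : C(UnitizedSpectrum B, ℂ) →⋆ₐ[ℂ] (H →L[ℂ] H) :=
  (Unitization.starLift ρ).comp (gelfandStarTransform (Unitization ℂ B)).symm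

theorem functionalCalculus_gelfand (u : Unitization ℂ B) :
    functionalCalculus ρ (gelfandStarTransform _ u) = Unitization.starLift ρ u := by
  simp [functionalCalculus]

theorem functionalCalculus_inr (b : B) :
    functionalCalculus ρ (gelfandStarTransform _ (b : Unitization ℂ B)) = ρ b := by
  rw [functionalCalculus_gelfand]
  exact DFunLike.congr_fun (Unitization.starLift.symm_apply_apply ρ) b

theorem gelfandStarTransform_apply (u : Unitization ℂ B) (χ : UnitizedSpectrum B) :
    gelfandStarTransform _ u χ = χ u := rfl

theorem continuous_gelfand_inr :
    Continuous fun b : B => gelfandStarTransform _ (b : Unitization ℂ B) :=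
  (gelfandTransform_isometry (Unitization ℂ B)).continuous.comp Unitization.isometry_inr.continuous

theorem exists_eq_gelfand (f : C(UnitizedSpectrum B, ℂ)) : ∃ (r : ℂ) (b : B),
    f = r • 1 + gelfandStarTransform _ (b : Unitization ℂ B) := by
  obtain ⟨u, rfl⟩ := (gelfandStarTransform (Unitization ℂ B)).surjective f
  induction u with
  | inl_add_inr r b =>
    refine ⟨r, b, ?_⟩
    ext χ
    change χ (Unitization.inl r + (b : Unitization ℂ B)) = r • 1 + χ (b : Unitization ℂ B)
    rw [map_add, apply_inl, smul_eq_mul, mul_one]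

variable {ρ}

open scoped CStarAlgebra in
theorem continuous_representation (ρ : B →⋆ₙₐ[ℂ] (H →L[ℂ] H)) : Continuous ρ :=
  map_continuous (ρ : B →⋆ₙₐ[ℂ] (H →L[ℂ] H))

/-- Gelfand transforms of elements of `B` vanish off the range, so every ρ(b) annihilates the
projection of the complement; non-degeneracy makes that projection 0. -/
theorem hasExtension_range (hι : DenseRange ι) (hρ : ∀ x, (∀ b, ρ b x = 0) → x = 0) :
    HasExtension (functionalCalculus ρ)
      ((Set.range (toUnitizedSpectrum (ι := ι))).indicator 1) 1 := by
  set R := Set.range (toUnitizedSpectrum (ι := ι)) with hR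
  have hmeas : MeasurableSet R := (isOpenEmbedding_toUnitizedSpectrum hι).isOpen_range.measurableSet
  have hp := hasExtension_proj (functionalCalculus ρ) Rᶜ hmeas.compl
  have h0 : proj (functionalCalculus ρ) Rᶜ hmeas.compl = 0 := by
    refine ContinuousLinearMap.ext fun x => hρ _ fun b => ?_
    have hb := HasExtension.coe_mul (gelfandStarTransform _ (b : Unitization ℂ B)) hp
    rw [functionalCalculus_inr] at hb
    have hz : ⇑(gelfandStarTransform _ (b : Unitization ℂ B)) * Rᶜ.indicator 1 = 0 := by
      ext χ
      by_cases hχ : χ ∈ R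
      · simp [hχ]
      · rw [hR, range_toUnitizedSpectrum hι] at hχ
        simp only [Set.mem_ofPred_eq, not_exists, not_not] at hχ
        simp [hχ]
    rw [hz] at hb
    have := hb.unique (by simpa using hasExtension_coe (φ := functionalCalculus ρ) 0)
    exact DFunLike.congr_fun this x
  have := (hasExtension_coe (φ := functionalCalculus ρ) 1).sub hp
  rw [h0, map_one, sub_zero] at this
  convert this using 1
  ext χ
  by_cases hχ : χ ∈ R <;> simp [hχ]

theorem nonempty_spectrumVia [Nontrivial H] (hι : DenseRange ι)
    (hρ : ∀ x, (∀ b, ρ b x = 0) → x = 0) : Nonempty (spectrumVia ι) := by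
  by_contra h
  -- With no characters, the identity would be the extension of the zero function.
  rw [not_nonempty_iff] at h
  have h1 := hasExtension_range hι hρ
  rw [Set.range_eq_empty, Set.indicator_empty'] at h1
  exact one_ne_zero (h1.unique (by simpa using hasExtension_coe (φ := functionalCalculus ρ) 0))

theorem eq_zero_of_functionalCalculus_eq_zero (hι : DenseRange ι) (hρ : Function.Injective ρ)
    (f : C(UnitizedSpectrum B, ℂ))
    (hf : ∀ χ ∉ Set.range (toUnitizedSpectrum (ι := ι)), f χ = 0)
    (h0 : functionalCalculus ρ f = 0) : f = 0 := by
  obtain ⟨r, b, rfl⟩ := exists_eq_gelfand f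
  -- The point at infinity, which kills `B` and lies outside the range: vanishing of f there removes
  -- the scalar part, and injectivity of ρ handles the rest.
  let χ : UnitizedSpectrum B := WeakDual.CharacterSpace.equivAlgHom.symm (Unitization.lift 0)
  have hχ : ∀ b : B, χ (b : Unitization ℂ B) = 0 := fun b => by
    rw [WeakDual.CharacterSpace.equivAlgHom_symm_coe]
    simp
  have hr := hf χ (by rw [range_toUnitizedSpectrum hι]; simpa using hχ)
  simp only [ContinuousMap.add_apply, ContinuousMap.smul_apply, ContinuousMap.one_apply,
    gelfandStarTransform_apply, hχ, add_zero, smul_eq_mul, mul_one] at hr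
  subst hr
  rw [map_add, map_smul, zero_smul, zero_add, functionalCalculus_inr] at h0
  rw [(map_eq_zero_iff ρ hρ).1 h0, Unitization.inr_zero, map_zero, add_zero]
  exact zero_smul ℂ (1 : C(UnitizedSpectrum B, ℂ))

theorem integral_eq_inner (hι : DenseRange ι) {Q : SpectralMeasure (spectrumVia ι) H}
    (hQ : ∀ a, Q.HasNormIntegral (fun σ => (σ : A →ₙₐ[ℂ] ℂ) a) (ρ (ι a)))
    (f : C(UnitizedSpectrum B, ℂ)) (x : H) :
    ∫ σ, f (toUnitizedSpectrum σ) ∂(Q.measure x) = inner ℂ x (functionalCalculus ρ f x) := by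
  have he := (isOpenEmbedding_toUnitizedSpectrum hι).continuous
  have hint : ∀ f : C(UnitizedSpectrum B, ℂ),
      Integrable (fun σ => f (toUnitizedSpectrum σ)) (Q.measure x) := fun f =>
    Integrable.of_bound (f.continuous.comp he).measurable.aestronglyMeasurable ‖f‖
      (.of_forall fun _ => f.norm_coe_le_norm _)
  have hcont : Continuous fun f : C(UnitizedSpectrum B, ℂ) =>
      ∫ σ, f (toUnitizedSpectrum σ) ∂(Q.measure x) := by
    refine (LipschitzWith.of_dist_le_mul (K := ⟨(Q.measure x).real Set.univ, measureReal_nonneg⟩)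
      fun f g => ?_).continuous
    rw [dist_eq_norm, ← integral_sub (hint f) (hint g), dist_eq_norm, mul_comm]
    exact norm_integral_le_of_norm_le_const (.of_forall fun σ => (f - g).norm_coe_le_norm _)
  have hB : ∀ b : B, ∫ σ, gelfandStarTransform _ (b : Unitization ℂ B) (toUnitizedSpectrum σ)
      ∂(Q.measure x) = inner ℂ x (ρ b x) := by
    refine fun b => congrFun (hι.equalizer (h := fun b => inner ℂ x (ρ b x))
      (hcont.comp continuous_gelfand_inr) ?_ ?_) b
    · exact continuous_const.inner ((continuous_representation ρ).clm_apply continuous_const)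
    · ext a
      simp only [Function.comp_apply, gelfandStarTransform_apply, toUnitizedSpectrum_apply]
      exact ((hQ a).inner_eq_integral x).symm
  obtain ⟨r, b, rfl⟩ := exists_eq_gelfand f
  -- Elements of `B` were settled by density of A; the scalar part needs only that the total mass is
  -- ⟨x, x⟩.
  have huniv := Q.inner_toFun ⟨Set.univ, MeasurableSet.univ⟩ x
  rw [Q.map_univ', one_apply_eq_self] at huniv
  rw [map_add, map_smul, map_one, functionalCalculus_inr, add_apply, inner_add_right, ← hB]
  simp only [ContinuousMap.add_apply]
  rw [integral_add (hint _) (hint _)]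
  congr 1
  rw [smul_apply, one_apply_eq_self, inner_smul_right, huniv]
  simp [mul_comm]

theorem commute_functionalCalculus (hι : DenseRange ι) {S : H →L[ℂ] H}
    (hS : ∀ a, ρ (ι a) * S = S * ρ (ι a)) (f : C(UnitizedSpectrum B, ℂ)) :
    S * functionalCalculus ρ f = functionalCalculus ρ f * S := by
  have hB : ∀ b, S * ρ b = ρ b * S := by
    refine fun b => congrFun (hι.equalizer (continuous_const.mul (continuous_representation ρ))
      ((continuous_representation ρ).mul continuous_const) ?_) b
    ext1 a
    exact (hS a).symm
  obtain ⟨r, b, rfl⟩ := exists_eq_gelfand f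
  simp [functionalCalculus_inr, mul_add, add_mul, hB]

/-- The spectral theorem for a faithful non-degenerate representation of a commutative
C⋆-algebra with a densely mapped algebra of coefficients. -/
theorem spectral_theorem [Nontrivial H] (hι : DenseRange ι) (hinj : Function.Injective ρ)
    (hρ : ∀ x, (∀ b, ρ b x = 0) → x = 0) :
    ∃ P : SpectralMeasure (spectrumVia ι) H,
      (P.IsResolutionOfIdentity ∧
        ∀ a : A, P.HasNormIntegral (fun σ => (σ : A →ₙₐ[ℂ] ℂ) a) (ρ (ι a))) ∧
      (∀ Q : SpectralMeasure (spectrumVia ι) H, Q.IsResolutionOfIdentity →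
        (∀ a : A, Q.HasNormIntegral (fun σ => (σ : A →ₙₐ[ℂ] ℂ) a) (ρ (ι a))) → Q = P) ∧
      Set.centralizer (Set.range fun a => ρ (ι a)) = Set.centralizer (Set.range P.toFun) ∧
      P.IsSupport Set.univ := by
  have := nonempty_spectrumVia hι hρ
  have he := isOpenEmbedding_toUnitizedSpectrum hι
  have h1 := hasExtension_range hι hρ
  have hP : ∀ a : A, (spectralMeasure he h1).HasNormIntegral
      (fun σ => (σ : A →ₙₐ[ℂ] ℂ) a) (ρ (ι a)) := fun a => by
    have := hasNormIntegral_spectralMeasure he h1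
      (gelfandStarTransform _ (ι a : Unitization ℂ B))
    rw [functionalCalculus_inr] at this
    convert this using 1
    ext σ
    exact (toUnitizedSpectrum_apply σ a).symm
  refine ⟨spectralMeasure he h1, ⟨isResolutionOfIdentity_spectralMeasure he h1, hP⟩,
    fun Q hQ hQa => eq_spectralMeasure he h1 hQ (integral_eq_inner hι hQa), ?_,
    isSupport_spectralMeasure he h1 (eq_zero_of_functionalCalculus_eq_zero hι hinj)⟩
  refine Set.Subset.antisymm (fun S hS => ?_) fun S hS => ?_
  · rintro _ ⟨ω, rfl⟩
    exact ((hasExtension_toFun he h1 ω).commute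
      (commute_functionalCalculus hι fun a => hS _ ⟨a, rfl⟩)).symm
  · rintro _ ⟨a, rfl⟩
    exact ((hP a).mem_centralizer_centralizer S hS).symm

end Representation

end SpectralConstruction

open SpectralConstruction

/-! ### The closed range as a commutative C⋆-algebra, and the conclusion. -/

section ClosedRange

variable {A : Type*} {H : Type*} [NonUnitalCommRing A] [Module ℂ A] [StarRing A]
  [NormedAddCommGroup H] [InnerProductSpace ℂ H] [CompleteSpace H] (π : StarRep A H)

theorem StarRep.isClosed_closedRange : IsClosed (π.closedRange : Set (H →L[ℂ] H)) :=
  isClosed_closure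

theorem StarRep.mul_comm_of_mem_closedRange {S T : H →L[ℂ] H} (hS : S ∈ π.closedRange)
    (hT : T ∈ π.closedRange) : S * T = T * S := by
  have hcomm : ∀ S T : NonUnitalStarAlgHom.range π.toStarHom, S * T = T * S := by
    rintro ⟨_, a, rfl⟩ ⟨_, b, rfl⟩
    refine Subtype.ext ?_
    change π.toStarHom a * π.toStarHom b = π.toStarHom b * π.toStarHom a
    rw [← map_mul, mul_comm, map_mul]
  exact congrArg Subtype.val ((NonUnitalStarSubalgebra.nonUnitalCommRingTopologicalClosure
    (NonUnitalStarAlgHom.range π.toStarHom) hcomm).mul_comm ⟨S, hS⟩ ⟨T, hT⟩)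

noncomputable instance : NonUnitalCommCStarAlgebra π.closedRange :=
  { NonUnitalStarSubalgebra.nonUnitalCStarAlgebra (h_closed := π.isClosed_closedRange)
      π.closedRange with
    mul_comm := fun S T => Subtype.ext (π.mul_comm_of_mem_closedRange S.2 T.2) }

theorem StarRep.denseRange_toClosedRange : DenseRange π.toClosedRange := by
  intro T
  rw [closure_subtype, ← Set.range_comp]
  exact T.2

end ClosedRange

theorem mainTheorem6 {A : Type*} {H : Type*}
    [NonUnitalCommRing A] [Module ℂ A] [IsScalarTower ℂ A A] [SMulCommClass ℂ A A]
    [StarRing A] [StarModule ℂ A]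
    [NormedAddCommGroup H] [InnerProductSpace ℂ H] [CompleteSpace H] [Nontrivial H]
    (π : StarRep A H) (hπ : π.NonDegenerate) :
    π.sp ⊆ hermitianMultFunctionals A ∧
    ∃ P : SpectralMeasure π.sp H,
      (P.IsResolutionOfIdentity ∧
        ∀ a : A, P.HasNormIntegral (fun σ : π.sp => (σ : A →ₙₐ[ℂ] ℂ) a) (π.toStarHom a)) ∧
      (∀ Q : SpectralMeasure π.sp H, Q.IsResolutionOfIdentity →
        (∀ a : A, Q.HasNormIntegral (fun σ : π.sp => (σ : A →ₙₐ[ℂ] ℂ) a) (π.toStarHom a)) →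
        Q = P) ∧
      Set.centralizer (Set.range π.toStarHom) = Set.centralizer (Set.range P.toFun) ∧
      P.IsSupport Set.univ :=
  ⟨spectrumVia_subset_hermitian (B := π.closedRange) π.denseRange_toClosedRange fun a =>
      Subtype.ext (map_star π.toStarHom a),
    spectral_theorem (B := π.closedRange) (ι := π.toClosedRange)
      (ρ := NonUnitalStarSubalgebraClass.subtype π.closedRange)
      π.denseRange_toClosedRange Subtype.val_injective
      fun x hx => hπ x fun a => hx (π.toClosedRange a)⟩
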